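/- A geometric graph is a simple graph drawn in the plane with its vertices at distinct points, no three of them collinear, and its edges drawn as straight-line segments. Let $\mathsf K^c_n$ denote a complete geometric graph on $n$ vertices in convex position. A decomposition $[\mathsf K^c_n,P]$ is a set $P$ of non-empty induced (hence complete) subgraphs such that every edge belongs to exactly one member of $P$. Two members of $P$ have nonempty intersection if they share a vertex or if an edge of one crosses an edge of the other. The chromatic index $\chi'([\mathsf K^c_n,P])$ is the smallest positive integer $m$ for which the edges can be colored with $m$ colors so that all edges of each member of $P$ have the same color and any two distinct members of $P$ with nonempty intersection have different colors. Theorem. Let $n=18k+1$ with $k$ even. For every such $n$ and every complete convex geometric graph $\mathsf K^c_n$ of order $n$ there exists a decomposition $[\mathsf K^c_n,P]$ such that each element of $P$ is a triangle and $$\chi'([\mathsf K^c_n,P])\le \frac{n^2}{36}+\Theta(n),$$ that is, there is a single function $g(n)=\Theta(n)$, depending only on $n$, such that $\chi'([\mathsf K^c_n,P])\le \frac{n^2}{36}+g(n)$. -/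

import Mathlib

/-- A geometric graph with vertex set `V`: a simple graph drawn in the plane with its vertices at
distinct points in general position (no three collinear) and its edges drawn as straight-line
segments. -/
structure GeometricGraph (V : Type*) where
  /-- the underlying abstract graph -/
  graph : SimpleGraph V
  /-- the point at which a vertex is drawn -/
  pos : V → EuclideanSpace ℝ (Fin 2)
  pos_injective : Function.Injective pos
  general_position : ∀ a b c : V, a ≠ b → b ≠ c → a ≠ c →
    ¬ Collinear ℝ {pos a, pos b, pos c}

/-- A decomposition of a simple graph: a set of induced subgraphs, each with at least one edge, such
that every edge of the graph belongs to exactly one of them. -/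
structure GraphDecomposition {V : Type*} (G : SimpleGraph V) where
  parts : Set G.Subgraph
  induced : ∀ H ∈ parts, H.IsInduced
  nonempty : ∀ H ∈ parts, H.edgeSet.Nonempty
  existsUnique_part : ∀ e ∈ G.edgeSet, ∃! H : G.Subgraph, H ∈ parts ∧ e ∈ H.edgeSet

/-- The subgraph is a triangle: three pairwise adjacent vertices. -/
def SimpleGraph.Subgraph.IsTriangle {V : Type*} {G : SimpleGraph V} (H : G.Subgraph) : Prop :=
  H.verts.ncard = 3 ∧ ∀ u ∈ H.verts, ∀ v ∈ H.verts, u ≠ v → H.Adj u v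

namespace GeometricGraph

variable {V : Type*}

/-- The complete geometric graph: any two distinct vertices are adjacent. -/
def IsComplete (K : GeometricGraph V) : Prop :=
  K.graph = ⊤

/-- The vertices are in convex position: no one of them lies in the convex hull of the others. -/
def InConvexPosition (K : GeometricGraph V) : Prop :=
  ConvexIndependent ℝ K.pos

/-- The segments `ab` and `cd` cross: they have a common relative interior point. (By general
position, distinct edges with a common end never do.) -/
def Crosses (K : GeometricGraph V) (a b c d : V) : Prop :=
  (openSegment ℝ (K.pos a) (K.pos b) ∩ openSegment ℝ (K.pos c) (K.pos d)).Nonempty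

/-- Two geometric subgraphs have nonempty intersection: they have a common vertex, or an edge of the
first crosses an edge of the second. -/
def Meet (K : GeometricGraph V) (H₁ H₂ : K.graph.Subgraph) : Prop :=
  (H₁.verts ∩ H₂.verts).Nonempty ∨
    ∃ a b c d : V, H₁.Adj a b ∧ H₂.Adj c d ∧ K.Crosses a b c d

/-- `c` is a `k`-`P`-coloring: every part is monochromatic, and any two distinct parts with nonempty
intersection have different colors. -/
def IsColoring (K : GeometricGraph V) (P : GraphDecomposition K.graph) {k : ℕ}
    (c : K.graph.edgeSet → Fin k) : Prop :=
  (∀ H ∈ P.parts, ∀ e f : K.graph.edgeSet,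
    (e : Sym2 V) ∈ H.edgeSet → (f : Sym2 V) ∈ H.edgeSet → c e = c f) ∧
  (∀ H₁ ∈ P.parts, ∀ H₂ ∈ P.parts, H₁ ≠ H₂ → K.Meet H₁ H₂ → ∀ e f : K.graph.edgeSet,
    (e : Sym2 V) ∈ H₁.edgeSet → (f : Sym2 V) ∈ H₂.edgeSet → c e ≠ c f)

/-- The positive integers `k` for which a `k`-`P`-coloring exists. -/
def colorNumbers (K : GeometricGraph V) (P : GraphDecomposition K.graph) : Set ℕ :=
  {k | 0 < k ∧ ∃ c : K.graph.edgeSet → Fin k, K.IsColoring P c}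

/-- The chromatic index of a decomposition of a geometric graph: the smallest positive integer `k`
for which there is a `k`-`P`-coloring. -/
noncomputable def chromaticIndex (K : GeometricGraph V) (P : GraphDecomposition K.graph) : ℕ :=
  sInf (K.colorNumbers P)

/-- For a finite vertex set some coloring always exists, so the minimum above is attained. -/
theorem colorNumbers_nonempty [Finite V] (K : GeometricGraph V) (P : GraphDecomposition K.graph) :
    (K.colorNumbers P).Nonempty := by
  classical
  have : Finite K.graph.Subgraph :=
    Finite.of_injective (fun H : K.graph.Subgraph => (H.verts, H.Adj)) (by
      intro H₁ H₂ h
      simp only [Prod.mk.injEq] at h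
      exact SimpleGraph.Subgraph.ext h.1 h.2)
  obtain ⟨m, ⟨φ⟩⟩ := Finite.exists_equiv_fin K.graph.Subgraph
  have hφ : Nonempty (Fin m) := ⟨φ ⊤⟩
  choose p hp hu using P.existsUnique_part
  refine ⟨m, Fin.pos_iff_nonempty.2 hφ, fun e => φ (p e e.2), ?_, ?_⟩
  · intro H hH e f he hf
    exact congrArg φ ((hu e e.2 H ⟨hH, he⟩).symm.trans (hu f f.2 H ⟨hH, hf⟩))
  · intro H₁ h₁ H₂ h₂ hne _ e f he hf h
    exact hne ((hu e e.2 H₁ ⟨h₁, he⟩).trans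
      ((φ.injective h).trans (hu f f.2 H₂ ⟨h₂, hf⟩).symm))

end GeometricGraph

/-!
Peltesohn's cyclic Steiner triple system gives `3 * k` base triangles in `ZMod n` whose rotations
contain every pair of points exactly once; rotating them around the polygon decomposes `K`. Two
triangles do not meet if an interval of the cyclic order contains one and avoids the other. Suitably
rotated, all base triangles but six form chains `r = 0, …, k - 3` of three nested triangles, where
chain `r` spans `8 * k + 2 * r + 3` points. Chains `r` and `k - 3 - r` together span
`18 * k < n` points, so they fit side by side and their six triangles share a color. This gives
`k / 2 + 6` colors up to rotation, hence `(k / 2 + 6) * n = n ^ 2 / 36 + O(n)` colors in all.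
-/

/-- Twice the signed area of the triangle `abc`: positive iff the triangle is counterclockwise. -/
def signedArea (a b c : EuclideanSpace ℝ (Fin 2)) : ℝ :=
  (b 0 - a 0) * (c 1 - a 1) - (b 1 - a 1) * (c 0 - a 0)

section SignedArea

variable {a b c d p : EuclideanSpace ℝ (Fin 2)}

theorem signedArea_rotate (a b c : EuclideanSpace ℝ (Fin 2)) :
    signedArea b c a = signedArea a b c := by
  unfold signedArea; ring

theorem signedArea_swap (a b c : EuclideanSpace ℝ (Fin 2)) :
    signedArea a c b = -signedArea a b c := by
  unfold signedArea; ring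

@[simp]
theorem signedArea_self_left (a b : EuclideanSpace ℝ (Fin 2)) : signedArea a a b = 0 := by
  unfold signedArea; ring

@[simp]
theorem signedArea_self_right (a b : EuclideanSpace ℝ (Fin 2)) : signedArea a b b = 0 := by
  unfold signedArea; ring

@[simp]
theorem signedArea_self_outer (a b : EuclideanSpace ℝ (Fin 2)) : signedArea a b a = 0 := by
  unfold signedArea; ring

theorem signedArea_eq_add (p a b c : EuclideanSpace ℝ (Fin 2)) :
    signedArea a b c = signedArea p a b + signedArea p b c + signedArea p c a := by
  unfold signedArea; ring

theorem signedArea_affine_combination (a b c d : EuclideanSpace ℝ (Fin 2)) {x y : ℝ}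
    (h : x + y = 1) :
    signedArea a b (x • c + y • d) = x * signedArea a b c + y * signedArea a b d := by
  obtain rfl : y = 1 - x := by linarith
  simp only [signedArea, PiLp.add_apply, PiLp.smul_apply, smul_eq_mul]
  ring

theorem collinear_of_signedArea_eq_zero (h : signedArea a b c = 0) : Collinear ℝ {a, b, c} := by
  obtain rfl | hab := eq_or_ne a b
  · simpa using collinear_pair ℝ a c
  have hsq : (b 0 - a 0) ^ 2 + (b 1 - a 1) ^ 2 ≠ 0 := by
    contrapose! hab
    ext i
    fin_cases i <;> dsimp only [Fin.zero_eta, Fin.mk_one] <;> nlinarith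
  let r := ((c 0 - a 0) * (b 0 - a 0) + (c 1 - a 1) * (b 1 - a 1)) /
    ((b 0 - a 0) ^ 2 + (b 1 - a 1) ^ 2)
  -- `r • (b - a)` is the orthogonal projection of `c - a` to the line spanned by `b - a`.
  have hc : c = r • (b - a) +ᵥ a := by
    unfold signedArea at h
    ext i
    fin_cases i <;>
    simp only [r, Fin.zero_eta, Fin.mk_one, vadd_eq_add, PiLp.add_apply, PiLp.smul_apply,
      PiLp.sub_apply, smul_eq_mul] <;>
    field_simp
    · linear_combination -(b 1 - a 1) * h
    · linear_combination (b 0 - a 0) * h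
  rw [collinear_iff_of_mem (Set.mem_insert a _)]
  refine ⟨b - a, ?_⟩
  rintro q (rfl | rfl | rfl)
  · exact ⟨0, by simp⟩
  · exact ⟨1, by simp⟩
  · exact ⟨r, hc⟩

theorem disjoint_openSegment_of_signedArea_pos (hc : 0 < signedArea a b c)
    (hd : 0 < signedArea a b d) : Disjoint (openSegment ℝ a b) (openSegment ℝ c d) := by
  rw [Set.disjoint_left]
  rintro _ ⟨x, y, -, -, hxy, rfl⟩ ⟨z, w, hz, hw, hzw, heq⟩
  have hab : signedArea a b (x • a + y • b) = 0 := by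
    simp [signedArea_affine_combination a b a b hxy]
  have hcd : 0 < signedArea a b (z • c + w • d) := by
    rw [signedArea_affine_combination a b c d hzw]
    positivity
  exact hcd.ne' (heq ▸ hab)

-- The three areas at `p` are, up to scale, the barycentric coordinates of `p`.
theorem mem_convexHull_of_signedArea_nonneg (hab : 0 ≤ signedArea p a b)
    (hbc : 0 ≤ signedArea p b c) (hca : 0 ≤ signedArea p c a) (habc : 0 < signedArea a b c) :
    p ∈ convexHull ℝ {a, b, c} := by
  let w := ![signedArea p b c, signedArea p c a, signedArea p a b]
  have hw : ∑ i, w i = signedArea a b c := by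
    rw [signedArea_eq_add p a b c, Fin.sum_univ_three]
    simp only [w, Matrix.cons_val]
    ring
  have hp : p = Finset.univ.centerMass w ![a, b, c] := by
    rw [Finset.centerMass, hw, eq_inv_smul_iff₀ habc.ne', Fin.sum_univ_three]
    ext i
    fin_cases i <;>
    · simp only [w, signedArea, Fin.zero_eta, Fin.mk_one, PiLp.add_apply, PiLp.smul_apply,
        smul_eq_mul, Matrix.cons_val]
      ring
  rw [hp]
  refine Finset.univ.centerMass_mem_convexHull (fun i _ => ?_) (hw ▸ habc) fun i _ => ?_
  · fin_cases i <;> assumption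
  · fin_cases i <;> simp

end SignedArea

namespace GeometricGraph

variable {V : Type*} {K : GeometricGraph V}

theorem signedArea_pos_or_pos (K : GeometricGraph V) {a b c : V} (hab : a ≠ b) (hbc : b ≠ c)
    (hac : a ≠ c) : 0 < signedArea (K.pos a) (K.pos b) (K.pos c) ∨
      0 < signedArea (K.pos a) (K.pos c) (K.pos b) := by
  rw [signedArea_swap (K.pos a) (K.pos b) (K.pos c), neg_pos, ← ne_iff_gt_or_lt]
  exact fun h => K.general_position a b c hab hbc hac (collinear_of_signedArea_eq_zero h)

theorem InConvexPosition.eq_of_mem_convexHull (h : K.InConvexPosition) {a b c p : V}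
    (hp : K.pos p ∈ convexHull ℝ {K.pos a, K.pos b, K.pos c}) : p = a ∨ p = b ∨ p = c := by
  simpa using h {a, b, c} p (by simpa [Set.image_insert_eq] using hp)

theorem InConvexPosition.signedArea_trans (h : K.InConvexPosition) {p a b c : V}
    (hab : 0 < signedArea (K.pos p) (K.pos a) (K.pos b))
    (hbc : 0 < signedArea (K.pos p) (K.pos b) (K.pos c)) :
    0 < signedArea (K.pos p) (K.pos a) (K.pos c) := by
  by_contra! hac
  rw [← neg_nonneg, ← signedArea_swap] at hac
  have habc : 0 < signedArea (K.pos a) (K.pos b) (K.pos c) := by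
    rw [signedArea_eq_add (K.pos p)]
    positivity
  obtain rfl | rfl | rfl :=
    h.eq_of_mem_convexHull (mem_convexHull_of_signedArea_nonneg hab.le hbc.le hac habc)
  all_goals simp at hab hbc

theorem InConvexPosition.signedArea_pos_of_pos (h : K.InConvexPosition) {p a b c : V}
    (hab : 0 < signedArea (K.pos p) (K.pos a) (K.pos b))
    (hbc : 0 < signedArea (K.pos p) (K.pos b) (K.pos c)) :
    0 < signedArea (K.pos a) (K.pos b) (K.pos c) := by
  by_contra! habc
  rw [← neg_nonneg, ← signedArea_swap, ← signedArea_rotate, ← signedArea_rotate] at habc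
  obtain rfl | rfl | rfl := h.eq_of_mem_convexHull (mem_convexHull_of_signedArea_nonneg
    (a := K.pos p) (b := K.pos a) (c := K.pos c)
    (by rw [signedArea_rotate, signedArea_rotate]; exact hab.le) habc
    (by rw [signedArea_rotate]; exact hbc.le) (h.signedArea_trans hab hbc))
  all_goals simp at hab hbc

/-- The order in which a ray turning counterclockwise about `p` meets the vertices, with `p` itself
as least element. It is a linear order because, in convex position, `p` sees the other vertices
within a half-plane. -/
def AngularLT (K : GeometricGraph V) (p a b : V) : Prop :=
  b ≠ p ∧ (a = p ∨ 0 < signedArea (K.pos p) (K.pos a) (K.pos b))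

theorem InConvexPosition.isStrictTotalOrder_angularLT (h : K.InConvexPosition) (p : V) :
    IsStrictTotalOrder V (K.AngularLT p) where
  irrefl := by
    rintro a ⟨hap, rfl | haa⟩
    · exact hap rfl
    · simp at haa
  trans := by
    rintro a b c ⟨hbp, hab⟩ ⟨hcp, hbc⟩
    exact ⟨hcp, hab.imp_right fun hab => h.signedArea_trans hab (hbc.resolve_left hbp)⟩
  trichotomous := by
    intro a b hnab hnba
    by_contra hab
    obtain rfl | hap := eq_or_ne a p
    · exact hnab ⟨Ne.symm hab, Or.inl rfl⟩
    obtain rfl | hbp := eq_or_ne b p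
    · exact hnba ⟨hap, Or.inl rfl⟩
    obtain hpab | hpba := K.signedArea_pos_or_pos hap.symm hab hbp.symm
    · exact hnab ⟨hbp, Or.inr hpab⟩
    · exact hnba ⟨hap, Or.inr hpba⟩

/-- The numbering `σ` lists vertices in counterclockwise order around a convex polygon. -/
def IsCounterclockwise {ι : Type*} [LT ι] (K : GeometricGraph V) (σ : ι → V) : Prop :=
  ∀ ⦃i j k : ι⦄, i < j → j < k → 0 < signedArea (K.pos (σ i)) (K.pos (σ j)) (K.pos (σ k))

theorem InConvexPosition.exists_isCounterclockwise [Finite V] (h : K.InConvexPosition) {n : ℕ}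
    (hn : Nat.card V = n) : ∃ σ : Fin n ≃ V, K.IsCounterclockwise σ := by
  classical
  have := Fintype.ofFinite V
  rw [Nat.card_eq_fintype_card] at hn
  obtain _ | ⟨⟨p⟩⟩ := isEmpty_or_nonempty V
  · let σ := (Fintype.equivFinOfCardEq hn).symm
    exact ⟨σ, fun i => isEmptyElim (σ i)⟩
  have := h.isStrictTotalOrder_angularLT p
  let : LinearOrder V := linearOrderOfSTO (K.AngularLT p)
  let σ : Fin n ≃o V := Fintype.orderIsoFinOfCardEq V hn
  refine ⟨σ.toEquiv, fun i j k hij hjk => ?_⟩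
  obtain ⟨hjp, hij⟩ : K.AngularLT p (σ i) (σ j) := σ.lt_iff_lt.2 hij
  obtain ⟨-, hjk⟩ : K.AngularLT p (σ j) (σ k) := σ.lt_iff_lt.2 hjk
  replace hjk := hjk.resolve_left hjp
  change 0 < signedArea (K.pos (σ i)) (K.pos (σ j)) (K.pos (σ k))
  obtain hip | hij := hij
  · rwa [hip]
  · exact h.signedArea_pos_of_pos hij hjk

theorem IsCounterclockwise.comp_add_left {n : ℕ} {σ : Fin n → V} (hσ : K.IsCounterclockwise σ)
    (t : Fin n) : K.IsCounterclockwise fun i => σ (t + i) := by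
  intro i j k hij hjk
  have hcyclic : (t + i < t + j ∧ t + j < t + k) ∨ (t + k < t + i ∧ t + i < t + j) ∨
      (t + j < t + k ∧ t + k < t + i) := by
    simp only [Fin.lt_def, Fin.val_add_eq_ite] at hij hjk ⊢
    split_ifs <;> omega
  obtain ⟨h₁, h₂⟩ | ⟨h₁, h₂⟩ | ⟨h₁, h₂⟩ := hcyclic
  · exact hσ h₁ h₂
  · rw [← signedArea_rotate, ← signedArea_rotate]; exact hσ h₁ h₂
  · rw [← signedArea_rotate]; exact hσ h₁ h₂

theorem crosses_comm {a b c d : V} : K.Crosses a b c d ↔ K.Crosses c d a b := by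
  rw [Crosses, Crosses, Set.inter_comm]

theorem crosses_swap {a b c d : V} : K.Crosses a b c d ↔ K.Crosses b a c d := by
  rw [Crosses, Crosses, openSegment_symm]

theorem Meet.symm {H₁ H₂ : K.graph.Subgraph} : K.Meet H₁ H₂ → K.Meet H₂ H₁ := by
  rintro (h | ⟨a, b, c, d, hab, hcd, h⟩)
  · exact Or.inl (by rwa [Set.inter_comm])
  · exact Or.inr ⟨c, d, a, b, hcd, hab, crosses_comm.1 h⟩

end GeometricGraph

/-- The set `s` is contained in an interval that avoids `t`. For two sets of vertices of a polygon
numbered in cyclic order, one of them is so separated from the other iff their convex hulls are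
disjoint. -/
def IntervalSeparated {ι : Type*} [Preorder ι] (s t : Set ι) : Prop :=
  ∃ I : Set ι, I.OrdConnected ∧ s ⊆ I ∧ Disjoint t I

namespace GeometricGraph

variable {V ι : Type*} {K : GeometricGraph V} [LinearOrder ι] {σ : ι → V}

theorem IsCounterclockwise.not_crosses (hσ : K.IsCounterclockwise σ) {I : Set ι}
    (hI : I.OrdConnected) {i j k l : ι} (hi : i ∈ I) (hj : j ∈ I) (hij : i ≠ j) (hk : k ∉ I)
    (hl : l ∉ I) : ¬ K.Crosses (σ i) (σ j) (σ k) (σ l) := by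
  wlog hlt : i < j generalizing i j
  · rw [crosses_swap]
    exact this hj hi hij.symm (hij.symm.lt_of_le (not_lt.1 hlt))
  have hpos : ∀ m ∉ I, 0 < signedArea (K.pos (σ i)) (K.pos (σ j)) (K.pos (σ m)) := by
    intro m hm
    obtain hmi | him := lt_or_ge m i
    · rw [signedArea_rotate]
      exact hσ hmi hlt
    · exact hσ hlt (not_le.1 fun hmj => hm (hI.out hi hj ⟨him, hmj⟩))
  rw [Crosses, Set.not_nonempty_iff_eq_empty, ← Set.disjoint_iff_inter_eq_empty]
  exact disjoint_openSegment_of_signedArea_pos (hpos k hk) (hpos l hl)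

theorem IsCounterclockwise.not_meet (hσ : K.IsCounterclockwise σ) (hinj : Function.Injective σ)
    {s t : Set ι} (hst : IntervalSeparated s t) :
    ¬ K.Meet ((⊤ : K.graph.Subgraph).induce (σ '' s)) ((⊤ : K.graph.Subgraph).induce (σ '' t)) := by
  obtain ⟨I, hI, hsI, htI⟩ := hst
  rw [Set.disjoint_left] at htI
  rintro (hv | ⟨_, _, _, _, ⟨⟨i, hi, rfl⟩, ⟨j, hj, rfl⟩, hij⟩, ⟨⟨k, hk, rfl⟩, ⟨l, hl, rfl⟩, -⟩, h⟩)
  · obtain ⟨_, ⟨i, hi, rfl⟩, ⟨j, hj, hij⟩⟩ := hv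
    exact htI hj (hinj hij ▸ hsI hi)
  · exact hσ.not_crosses hI (hsI hi) (hsI hj) (fun h => hij.ne (congrArg σ h)) (htI hk) (htI hl) h

end GeometricGraph

namespace GraphDecomposition

variable {V J : Type*} {G : SimpleGraph V} {S : J → Set V}

theorem existsUnique_mem_edgeSet_induce (hS : ∀ u v, G.Adj u v → ∃! j, u ∈ S j ∧ v ∈ S j)
    {e : Sym2 V} (he : e ∈ G.edgeSet) :
    ∃! j, e ∈ ((⊤ : G.Subgraph).induce (S j)).edgeSet := by
  induction e with
  | _ u v =>
    rw [SimpleGraph.mem_edgeSet] at he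
    simpa [he] using hS u v he

/-- The decomposition into the subgraphs induced on the vertex sets `S j`, which are to contain
every pair of adjacent vertices exactly once. -/
def ofBlocks (S : J → Set V) (hne : ∀ j, ∃ u ∈ S j, ∃ v ∈ S j, G.Adj u v)
    (hS : ∀ u v, G.Adj u v → ∃! j, u ∈ S j ∧ v ∈ S j) : GraphDecomposition G where
  parts := Set.range fun j => (⊤ : G.Subgraph).induce (S j)
  induced := by
    rintro _ ⟨j, rfl⟩ u hu v hv huv
    exact ⟨hu, hv, huv⟩
  nonempty := by
    rintro _ ⟨j, rfl⟩
    obtain ⟨u, hu, v, hv, huv⟩ := hne j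
    exact ⟨s(u, v), hu, hv, huv⟩
  existsUnique_part := by
    intro e he
    obtain ⟨j, hj, hunique⟩ := existsUnique_mem_edgeSet_induce hS he
    refine ⟨_, ⟨⟨j, rfl⟩, hj⟩, ?_⟩
    rintro _ ⟨⟨i, rfl⟩, hi⟩
    rw [hunique i hi]

end GraphDecomposition

theorem GeometricGraph.chromaticIndex_ofBlocks_le {V J C : Type*} [Finite C] [Nonempty C]
    {K : GeometricGraph V} {S : J → Set V} (hne : ∀ j, ∃ u ∈ S j, ∃ v ∈ S j, K.graph.Adj u v)
    (hS : ∀ u v, K.graph.Adj u v → ∃! j, u ∈ S j ∧ v ∈ S j) (color : J → C)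
    (hcolor : ∀ i j, i ≠ j → color i = color j →
      ¬ K.Meet ((⊤ : K.graph.Subgraph).induce (S i)) ((⊤ : K.graph.Subgraph).induce (S j))) :
    K.chromaticIndex (.ofBlocks S hne hS) ≤ Nat.card C := by
  choose block _ hblock using fun e : K.graph.edgeSet =>
    GraphDecomposition.existsUnique_mem_edgeSet_induce hS e.2
  refine Nat.sInf_le ⟨Nat.card_pos, fun e => Finite.equivFin C (color (block e)), ?_, ?_⟩
  · rintro _ ⟨j, rfl⟩ e f he hf
    exact congrArg (fun j => Finite.equivFin C (color j))
      ((hblock e j he).symm.trans (hblock f j hf))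
  · rintro _ ⟨i, rfl⟩ _ ⟨j, rfl⟩ hij hmeet e f he hf hef
    rw [EmbeddingLike.apply_eq_iff_eq, ← hblock e i he, ← hblock f j hf] at hef
    exact hcolor i j (fun h => hij (by rw [h])) hef hmeet

/-- A `(G, k, 1)` difference family with `k`-element base blocks `range (B i)`: each nonzero
element of `G` is the difference of exactly one pair of points in a common block. -/
structure IsDifferenceFamily {G I A : Type*} [AddCommGroup G] (B : I → A → G) : Prop where
  injective (i : I) : Function.Injective (B i)
  existsUnique_sub_eq {d : G} : d ≠ 0 → ∃! x : I × A × A, B x.1 x.2.2 - B x.1 x.2.1 = d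

namespace IsDifferenceFamily

variable {G I A : Type*} [AddCommGroup G] {B : I → A → G}

theorem of_card_le [Finite I] [Finite A]
    (hsurj : ∀ d ≠ 0, ∃ i a b, B i b - B i a = d)
    (hcard : Nat.card I * Nat.card {x : A × A // x.1 ≠ x.2} + 1 ≤ Nat.card G) :
    IsDifferenceFamily B := by
  let sub : Option (I × {x : A × A // x.1 ≠ x.2}) → G :=
    fun o => o.elim 0 fun x => B x.1 x.2.1.2 - B x.1 x.2.1.1
  have hbij : Function.Bijective sub := by
    refine Function.Surjective.bijective_of_nat_card_le (fun d => ?_) ?_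
    · obtain rfl | hd := eq_or_ne d 0
      · exact ⟨none, rfl⟩
      · obtain ⟨i, a, b, h⟩ := hsurj d hd
        have hab : a ≠ b := by
          rintro rfl
          exact hd (by rw [← h, sub_self])
        exact ⟨some (i, ⟨(a, b), hab⟩), h⟩
    · rwa [Finite.card_option, Nat.card_prod]
  refine { injective := fun i a b h => ?_, existsUnique_sub_eq := fun {d} hd => ?_ }
  · by_contra hab
    have := hbij.1 (a₁ := some (i, ⟨(a, b), hab⟩)) (a₂ := none) (sub_eq_zero.2 h.symm)
    cases this
  · obtain ⟨i, a, b, h⟩ := hsurj d hd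
    refine ⟨(i, a, b), h, ?_⟩
    rintro ⟨j, a', b'⟩ h'
    have hne : ∀ {k x y}, B k y - B k x = d → x ≠ y := by
      rintro k x _ hxy rfl
      exact hd (by rw [← hxy, sub_self])
    have := hbij.1 (a₁ := some (j, ⟨(a', b'), hne h'⟩)) (a₂ := some (i, ⟨(a, b), hne h⟩))
      (h'.trans h.symm)
    simpa using this

theorem existsUnique_translate (hB : IsDifferenceFamily B) {x y : G} (hxy : x ≠ y) :
    ∃! p : I × G, x ∈ Set.range (fun a => p.2 + B p.1 a) ∧
      y ∈ Set.range (fun a => p.2 + B p.1 a) := by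
  obtain ⟨⟨i, a, b⟩, hab, hunique⟩ := hB.existsUnique_sub_eq (sub_ne_zero.2 hxy.symm)
  dsimp only at hab
  refine ⟨(i, x - B i a), ⟨⟨a, sub_add_cancel _ _⟩, ⟨b, ?_⟩⟩, ?_⟩
  · change x - B i a + B i b = y
    rw [sub_add_eq_add_sub, add_sub_assoc, hab, add_sub_cancel]
  · rintro ⟨j, t⟩ ⟨⟨a', rfl⟩, ⟨b', rfl⟩⟩
    obtain ⟨rfl, rfl, rfl⟩ : j = i ∧ a' = a ∧ b' = b := by
      simpa using hunique (j, a', b') (add_sub_add_left_eq_sub _ _ _).symm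
    rw [add_sub_cancel_right]

end IsDifferenceFamily

/-- The point `y` of the base block `{0, y, z}`, `y < z`, with index `(f, r)` in Peltesohn's cyclic
Steiner triple system of order `18 * s + 1`. The blocks are numbered such that for `r + 3 ≤ s` the
blocks `(0, r)`, `(1, r)`, `(2, r)` can be nested. -/
def peltesohnMid (s : ℕ) (f : Fin 3) (r : ℕ) : ℕ :=
  match f with
  | 0 => 8 * s - r
  | 1 => if r + 3 ≤ s then 4 * s + 2 * r + 5 else if r + 2 = s then 4 * s + 3 else 3 * s + 1
  | 2 => 4 * s + 1 - r

/-- The point `z` of the base block `{0, y, z}`, `y < z`, with index `(f, r)` in Peltesohn's cyclic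
Steiner triple system of order `18 * s + 1`. -/
def peltesohnEnd (s : ℕ) (f : Fin 3) (r : ℕ) : ℕ :=
  match f with
  | 0 => 8 * s + 2 * r + 2
  | 1 => if r + 3 ≤ s then 7 * s - r - 1 else if r + 2 = s then 7 * s else 6 * s + 1
  | 2 => 4 * s + 2 * r + 2

/-- Where the `r`-th chain of nested triangles starts. The chains `r` and `s - 3 - r` are placed
side by side; the triangle of chain `r` that contains the others ends
`8 * s + 2 * r + 2` points after its start. -/
def chainStart (s r : ℕ) : ℕ :=
  if 2 * r + 3 < s then 0 else 8 * s + 2 * (s - 3 - r) + 3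

/-- The first point of the triangle with index `(f, r)`, which is innermost in its chain for
`f = 2`. The triangles with `s < r + 3` are in no chain. -/
def triangleStart (s : ℕ) (f : Fin 3) (r : ℕ) : ℕ :=
  if r + 3 ≤ s then chainStart s r + f else 0

/-- The three points, in increasing order, of the triangle with index `(f, r)`. -/
def trianglePoint (s : ℕ) (f : Fin 3) (r : ℕ) : Fin 3 → ℕ :=
  ![triangleStart s f r, triangleStart s f r + peltesohnMid s f r,
    triangleStart s f r + peltesohnEnd s f r]

/-- The colors of the triangles up to rotation: one for each pair of chains `r` and `s - 3 - r`,
and one for each of the six triangles in no chain. -/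
abbrev ColorClass (s : ℕ) : Type := Fin (s / 2) ⊕ Fin 3 × Fin 2

/-- The color of the triangle with index `(f, r)`. -/
def colorClass {s : ℕ} (i : Fin 3 × Fin s) : ColorClass s :=
  if h : i.2 + 3 ≤ s then .inl ⟨min i.2 (s - 3 - i.2), by omega⟩
  else .inr (i.1, ⟨s - 1 - i.2, by omega⟩)

-- The differences up to `3 * s` are the sides `z - y`, in the residue classes 1, 2, 0 modulo 3 for
-- the blocks `(2, r)`, `(0, r)`, `(1, r)`; the larger ones are the sides `y` and the lengths of the
-- sides `z`, namely `z` or `18 * s + 1 - z`.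
theorem exists_peltesohn_side_eq {s d : ℕ} (hd : 0 < d) (hds : d ≤ 9 * s) :
    ∃ f, ∃ r < s, peltesohnMid s f r = d ∨ peltesohnEnd s f r = d ∨
      peltesohnMid s f r + d = peltesohnEnd s f r ∨ peltesohnEnd s f r + d = 18 * s + 1 := by
  by_cases h3 : d ≤ 3 * s
  · obtain h | h | h : d % 3 = 1 ∨ d % 3 = 2 ∨ d % 3 = 0 := by omega
    · exact ⟨2, (d - 1) / 3, by omega, by simp only [peltesohnMid, peltesohnEnd]; omega⟩
    · exact ⟨0, (d - 2) / 3, by omega, by simp only [peltesohnMid, peltesohnEnd]; omega⟩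
    · refine ⟨1, if d + 6 ≤ 3 * s then s - 2 - d / 3 else if d + 3 = 3 * s then s - 2 else s - 1,
        ?_⟩
      simp only [peltesohnMid, peltesohnEnd]
      split_ifs <;> omega
  by_cases hlast : d = 3 * s + 1 ∨ d = 6 * s + 1
  · refine ⟨1, s - 1, by omega, ?_⟩
    simp only [peltesohnMid, peltesohnEnd]
    split_ifs <;> omega
  by_cases h4 : d ≤ 4 * s + 1
  · exact ⟨2, 4 * s + 1 - d, by omega, by simp only [peltesohnMid]; omega⟩
  by_cases h6 : d ≤ 6 * s
  · obtain ⟨e, rfl | rfl⟩ := d.even_or_odd'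
    · exact ⟨2, e - (2 * s + 1), by omega, by simp only [peltesohnEnd]; omega⟩
    · refine ⟨1, if e = 2 * s + 1 then s - 2 else e - (2 * s + 2), ?_⟩
      simp only [peltesohnMid, peltesohnEnd]
      split_ifs <;> omega
  by_cases h7 : d ≤ 7 * s
  · refine ⟨1, if d = 7 * s then s - 2 else 7 * s - 1 - d, ?_⟩
    simp only [peltesohnMid, peltesohnEnd]
    split_ifs <;> omega
  by_cases h8 : d ≤ 8 * s
  · exact ⟨0, 8 * s - d, by omega, by simp only [peltesohnMid]; omega⟩
  obtain ⟨e, rfl | rfl⟩ := d.even_or_odd'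
  · exact ⟨0, e - (4 * s + 1), by omega, by simp only [peltesohnEnd]; omega⟩
  · exact ⟨0, 5 * s - 1 - e, by omega, by simp only [peltesohnEnd]; omega⟩

theorem peltesohnMid_le_peltesohnEnd {s : ℕ} (f : Fin 3) {r : ℕ} (hr : r < s) :
    peltesohnMid s f r ≤ peltesohnEnd s f r := by
  fin_cases f <;> dsimp only [peltesohnMid, peltesohnEnd]
  · omega
  · split_ifs <;> omega
  · omega

theorem peltesohnEnd_le {s : ℕ} (f : Fin 3) {r : ℕ} (hr : r < s) :
    peltesohnEnd s f r ≤ 18 * s := by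
  fin_cases f <;> dsimp only [peltesohnEnd]
  · omega
  · split_ifs <;> omega
  · omega

theorem trianglePoint_mem_Icc {s r : ℕ} (hr : r + 3 ≤ s) (f a : Fin 3) :
    trianglePoint s f r a ∈ Set.Icc (chainStart s r) (chainStart s r + (8 * s + 2 * r + 2)) := by
  fin_cases f <;> fin_cases a <;>
    simp only [trianglePoint, triangleStart, peltesohnMid, peltesohnEnd, hr, ↓reduceIte,
      Fin.zero_eta, Fin.mk_one, Fin.reduceFinMk, Matrix.cons_val, Set.mem_Icc] <;>
    omega

theorem trianglePoint_mem_Ioo {s r : ℕ} (hr : r + 3 ≤ s) {f f' : Fin 3} (hf : f < f')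
    (a : Fin 3) :
    trianglePoint s f' r a ∈ Set.Ioo (trianglePoint s f r 0) (trianglePoint s f r 1) := by
  fin_cases f <;> fin_cases f' <;> try exact absurd hf (by decide)
  all_goals
    fin_cases a <;>
      simp only [trianglePoint, triangleStart, peltesohnMid, peltesohnEnd, hr, ↓reduceIte,
        Fin.zero_eta, Fin.mk_one, Fin.reduceFinMk, Matrix.cons_val, Set.mem_Ioo] <;>
      omega

theorem trianglePoint_lt {s r : ℕ} (hr : r < s) (f a : Fin 3) :
    trianglePoint s f r a < 18 * s + 1 := by
  by_cases h : r + 3 ≤ s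
  · have := (trianglePoint_mem_Icc h f a).2
    unfold chainStart at this
    split_ifs at this <;> omega
  · have := peltesohnMid_le_peltesohnEnd f hr
    have := peltesohnEnd_le f hr
    fin_cases a <;>
      simp only [trianglePoint, triangleStart, h, ↓reduceIte, Fin.zero_eta, Fin.mk_one,
        Fin.reduceFinMk, Matrix.cons_val] <;>
      omega

theorem chainStart_add_lt {s r r' : ℕ} (hlt : r < r') (hrr' : r + r' + 3 = s) :
    chainStart s r + (8 * s + 2 * r + 2) < chainStart s r' := by
  unfold chainStart
  split_ifs <;> omega

/-- Peltesohn's base blocks, each translated to its place in its color class. -/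
def peltesohnBlock {s : ℕ} (i : Fin 3 × Fin s) (a : Fin 3) : Fin (18 * s + 1) :=
  ⟨trianglePoint s i.1 i.2 a, trianglePoint_lt i.2.2 i.1 a⟩

theorem peltesohnBlock_add_eq {s : ℕ} {i : Fin 3 × Fin s} {a b : Fin 3} {d : Fin (18 * s + 1)}
    (h : trianglePoint s i.1 i.2 a + d = trianglePoint s i.1 i.2 b ∨
      trianglePoint s i.1 i.2 a + d = trianglePoint s i.1 i.2 b + (18 * s + 1)) :
    peltesohnBlock i a + d = peltesohnBlock i b := by
  have hb := trianglePoint_lt i.2.2 i.1 b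
  rw [Fin.ext_iff, Fin.val_add]
  obtain h | h := h
  · rw [peltesohnBlock, peltesohnBlock, h, Nat.mod_eq_of_lt hb]
  · rw [peltesohnBlock, peltesohnBlock, h, Nat.add_mod_right, Nat.mod_eq_of_lt hb]

theorem exists_peltesohnBlock_add_eq {s : ℕ} {d : Fin (18 * s + 1)} (hd : 0 < d.val)
    (hds : d.val ≤ 9 * s) :
    ∃ (i : Fin 3 × Fin s) (a b : Fin 3), peltesohnBlock i a + d = peltesohnBlock i b := by
  obtain ⟨f, r, hr, h | h | h | h⟩ := exists_peltesohn_side_eq hd hds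
  · refine ⟨(f, ⟨r, hr⟩), 0, 1, peltesohnBlock_add_eq ?_⟩
    simp only [trianglePoint, Matrix.cons_val]
    omega
  · refine ⟨(f, ⟨r, hr⟩), 0, 2, peltesohnBlock_add_eq ?_⟩
    simp only [trianglePoint, Matrix.cons_val]
    omega
  · refine ⟨(f, ⟨r, hr⟩), 1, 2, peltesohnBlock_add_eq ?_⟩
    simp only [trianglePoint, Matrix.cons_val]
    omega
  · refine ⟨(f, ⟨r, hr⟩), 2, 0, peltesohnBlock_add_eq ?_⟩
    simp only [trianglePoint, Matrix.cons_val]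
    omega

theorem exists_peltesohnBlock_sub_eq {s : ℕ} {d : Fin (18 * s + 1)} (hd : d ≠ 0) :
    ∃ (i : Fin 3 × Fin s) (a b : Fin 3), peltesohnBlock i b - peltesohnBlock i a = d := by
  have hd0 : 0 < d.val := Fin.pos_iff_ne_zero.2 hd
  obtain hle | hgt := le_or_gt d.val (9 * s)
  · obtain ⟨i, a, b, h⟩ := exists_peltesohnBlock_add_eq hd0 hle
    exact ⟨i, a, b, by rw [← h, add_sub_cancel_left]⟩
  · have hneg : (-d).val = 18 * s + 1 - d.val := by
      rw [Fin.val_neg, if_neg hd]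
    obtain ⟨i, a, b, h⟩ := exists_peltesohnBlock_add_eq (d := -d) (by omega) (by omega)
    exact ⟨i, b, a, by rw [← h, sub_add_cancel_left, neg_neg]⟩

theorem isDifferenceFamily_peltesohnBlock (s : ℕ) :
    IsDifferenceFamily (peltesohnBlock (s := s)) := by
  refine .of_card_le (fun d hd => exists_peltesohnBlock_sub_eq hd) ?_
  have hpairs : Nat.card {x : Fin 3 × Fin 3 // x.1 ≠ x.2} = 6 := by
    rw [Nat.card_eq_fintype_card]
    decide
  simp only [hpairs, Nat.card_prod, Nat.card_fin]
  omega

theorem chain_of_colorClass_eq {s : ℕ} {i j : Fin 3 × Fin s} (hij : i ≠ j)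
    (h : colorClass i = colorClass j) :
    i.2 + 3 ≤ s ∧ (i.2 = j.2 ∨ (i.2 : ℕ) + j.2 + 3 = s) := by
  obtain ⟨f, r⟩ := i
  obtain ⟨f', r'⟩ := j
  simp only [ne_eq, Prod.mk.injEq, Fin.ext_iff] at hij ⊢
  simp only [colorClass] at h
  split_ifs at h with hr hr'
  · simp only [Sum.inl.injEq, Fin.mk.injEq] at h
    omega
  · simp only [Sum.inr.injEq, Prod.mk.injEq, Fin.ext_iff] at h
    omega

theorem intervalSeparated_of_nested {s : ℕ} {f f' : Fin 3} {r : Fin s} (hr : r + 3 ≤ s)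
    (hf : f < f') : IntervalSeparated (Set.range (peltesohnBlock (f', r)))
      (Set.range (peltesohnBlock (f, r))) := by
  refine ⟨Set.Ioo (peltesohnBlock (f, r) 0) (peltesohnBlock (f, r) 1), Set.ordConnected_Ioo,
    Set.range_subset_iff.2 fun a => trianglePoint_mem_Ioo hr hf a, ?_⟩
  rw [Set.disjoint_left]
  rintro _ ⟨a, rfl⟩ ⟨h0, h1⟩
  have hle : peltesohnBlock (f, r) 1 ≤ peltesohnBlock (f, r) 2 :=
    Nat.add_le_add_left (peltesohnMid_le_peltesohnEnd f r.2) _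
  fin_cases a
  · exact h0.false
  · exact h1.false
  · exact h1.not_ge hle

theorem intervalSeparated_of_complementary {s : ℕ} {r r' : Fin s} (hr : r < r')
    (hrr' : (r : ℕ) + r' + 3 = s) (f f' : Fin 3) :
    IntervalSeparated (Set.range (peltesohnBlock (f, r)))
      (Set.range (peltesohnBlock (f', r'))) := by
  refine ⟨Fin.val ⁻¹' Set.Iio (chainStart s r'),
    Set.ordConnected_Iio.preimage_mono Fin.val_strictMono.monotone,
    Set.range_subset_iff.2 fun a => ?_, ?_⟩
  · exact (trianglePoint_mem_Icc (r := r) (by omega) f a).2.trans_lt (chainStart_add_lt hr hrr')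
  · rw [Set.disjoint_left]
    rintro _ ⟨a, rfl⟩ h
    exact h.not_ge (trianglePoint_mem_Icc (r := r') (by omega) f' a).1

theorem intervalSeparated_of_colorClass_eq {s : ℕ} {i j : Fin 3 × Fin s} (hij : i ≠ j)
    (h : colorClass i = colorClass j) :
    IntervalSeparated (Set.range (peltesohnBlock i)) (Set.range (peltesohnBlock j)) ∨
      IntervalSeparated (Set.range (peltesohnBlock j)) (Set.range (peltesohnBlock i)) := by
  obtain ⟨hr, hchain⟩ := chain_of_colorClass_eq hij h
  obtain ⟨f, r⟩ := i
  obtain ⟨f', r'⟩ := j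
  dsimp only at hr hchain
  obtain hlt | rfl | hlt := lt_trichotomy r r'
  · exact .inl (intervalSeparated_of_complementary hlt (hchain.resolve_left hlt.ne) f f')
  · obtain hf | hf := lt_or_gt_of_ne fun hf : f = f' => hij (by rw [hf])
    · exact .inr (intervalSeparated_of_nested hr hf)
    · exact .inl (intervalSeparated_of_nested hr hf)
  · rw [add_comm (r : ℕ)] at hchain
    exact .inr (intervalSeparated_of_complementary hlt (hchain.resolve_left hlt.ne') f' f)

section TriangleVerts

variable {V : Type*} {k : ℕ}

/-- Peltesohn's base blocks rotated by `p.2`, as sets of vertices of a polygon numbered by `σ`. -/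
def triangleVerts (σ : Fin (18 * k + 1) ≃ V) (p : (Fin 3 × Fin k) × Fin (18 * k + 1)) : Set V :=
  (fun i => σ (p.2 + i)) '' Set.range (peltesohnBlock p.1)

theorem ncard_triangleVerts (σ : Fin (18 * k + 1) ≃ V)
    (p : (Fin 3 × Fin k) × Fin (18 * k + 1)) : (triangleVerts σ p).ncard = 3 := by
  have hinj : Function.Injective fun i => σ (p.2 + i) :=
    σ.injective.comp (add_right_injective p.2)
  rw [triangleVerts, Set.ncard_image_of_injective _ hinj,
    Set.ncard_range_of_injective ((isDifferenceFamily_peltesohnBlock k).injective p.1),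
    Nat.card_fin]

theorem existsUnique_triangleVerts (σ : Fin (18 * k + 1) ≃ V) {u v : V} (huv : u ≠ v) :
    ∃! p, u ∈ triangleVerts σ p ∧ v ∈ triangleVerts σ p := by
  have hmem (p : (Fin 3 × Fin k) × Fin (18 * k + 1)) (w : V) : w ∈ triangleVerts σ p ↔
      σ.symm w ∈ Set.range fun a => p.2 + peltesohnBlock p.1 a := by
    simp [triangleVerts, Equiv.eq_symm_apply]
  simp only [hmem]
  exact (isDifferenceFamily_peltesohnBlock k).existsUnique_translate (σ.symm.injective.ne huv)

theorem GeometricGraph.IsCounterclockwise.not_meet_triangleVerts {K : GeometricGraph V}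
    {σ : Fin (18 * k + 1) ≃ V} (hσ : K.IsCounterclockwise σ) {i j : Fin 3 × Fin k} (hij : i ≠ j)
    (h : colorClass i = colorClass j) (t : Fin (18 * k + 1)) :
    ¬ K.Meet ((⊤ : K.graph.Subgraph).induce (triangleVerts σ (i, t)))
      ((⊤ : K.graph.Subgraph).induce (triangleVerts σ (j, t))) := by
  have hrot := hσ.comp_add_left t
  have hinj : Function.Injective fun i => σ (t + i) := σ.injective.comp (add_right_injective t)
  obtain hsep | hsep := intervalSeparated_of_colorClass_eq hij h
  · exact hrot.not_meet hinj hsep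
  · exact fun hmeet => hrot.not_meet hinj hsep hmeet.symm

end TriangleVerts

theorem GeometricGraph.IsComplete.adj_iff {V : Type*} {K : GeometricGraph V} (hK : K.IsComplete)
    {u v : V} : K.graph.Adj u v ↔ u ≠ v := by
  rw [hK, SimpleGraph.top_adj]

theorem card_colors_le (k : ℕ) : (Nat.card (ColorClass k × Fin (18 * k + 1)) : ℝ) ≤
    ((18 * k + 1 : ℕ) : ℝ) ^ 2 / 36 + 6 * (18 * k + 1 : ℕ) := by
  calc (Nat.card (ColorClass k × Fin (18 * k + 1)) : ℝ)
      = ((k / 2 : ℕ) + 6) * (18 * k + 1) := by simp [ColorClass]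
    _ ≤ ((k : ℝ) / 2 + 6) * (18 * k + 1) := by
      gcongr
      exact Nat.cast_div_le
    _ ≤ ((18 * k + 1 : ℕ) : ℝ) ^ 2 / 36 + 6 * (18 * k + 1 : ℕ) := by
      push_cast
      nlinarith

theorem theorem3p2_general {V : Type*} {k n : ℕ} (hn : n = 18 * k + 1) (hV : Nat.card V = n)
    {K : GeometricGraph V} (hK : K.IsComplete) (hconv : K.InConvexPosition) :
    ∃ P : GraphDecomposition K.graph, (∀ H ∈ P.parts, H.IsTriangle) ∧
      (K.chromaticIndex P : ℝ) ≤ (n : ℝ) ^ 2 / 36 + 6 * n := by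
  subst hn
  have : Finite V := Nat.finite_of_card_ne_zero (by omega)
  obtain ⟨σ, hσ⟩ := hconv.exists_isCounterclockwise hV
  have hne (p) : ∃ u ∈ triangleVerts σ p, ∃ v ∈ triangleVerts σ p, K.graph.Adj u v := by
    simp only [hK.adj_iff]
    exact Set.one_lt_ncard_iff_nontrivial.1 (by rw [ncard_triangleVerts]; norm_num)
  have hunique (u v) (huv : K.graph.Adj u v) := existsUnique_triangleVerts σ huv.ne
  refine ⟨.ofBlocks (triangleVerts σ) hne hunique, ?_, ?_⟩
  · rintro _ ⟨p, rfl⟩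
    exact ⟨ncard_triangleVerts σ p, fun u hu v hv huv => ⟨hu, hv, hK.adj_iff.2 huv⟩⟩
  · refine (Nat.cast_le.2 (GeometricGraph.chromaticIndex_ofBlocks_le hne hunique
      (fun p => (colorClass p.1, p.2)) ?_)).trans (card_colors_le k)
    rintro ⟨i, t⟩ ⟨j, t'⟩ hij h
    obtain ⟨hcolor, rfl : t = t'⟩ := Prod.mk.inj h
    exact hσ.not_meet_triangleVerts (fun hij' : i = j => hij (by rw [hij'])) hcolor t

theorem theorem3p2 :
    ∃ g : ℕ → ℝ, Asymptotics.IsTheta Filter.atTop g (fun n : ℕ => (n : ℝ)) ∧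
      ∀ k n : ℕ, Even k → n = 18 * k + 1 →
        ∀ K : GeometricGraph (Fin n), K.IsComplete → K.InConvexPosition →
          ∃ P : GraphDecomposition K.graph,
            (∀ H ∈ P.parts, H.IsTriangle) ∧
              (K.chromaticIndex P : ℝ) ≤ (n : ℝ) ^ 2 / 36 + g n :=
  ⟨fun n => 6 * n, (Asymptotics.isTheta_refl _ _).const_mul_left (by norm_num),
    fun _ n _ hn _ hK hconv => theorem3p2_general hn (Nat.card_fin n) hK hconv⟩
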